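/- Let $\alpha>0$. Let $\{X_t,t\ge1\}$ be a sequence of identically distributed, almost surely positive random variables which are pairwise asymptotically independent, that is, $\mathbb P[X_t>x]>0$ for all $x$ and all $t$, and for all $s\ne t$, $$\lim_{x\to\infty}\frac{\mathbb P[X_s>x,\,X_t>x]}{\mathbb P[X_s>x]}=\lim_{x\to\infty}\frac{\mathbb P[X_s>x,\,X_t>x]}{\mathbb P[X_t>x]}=0 .$$ Let $\{\Theta_t,t\ge1\}$ be a sequence of almost surely positive random variables such that the sequence $\{\Theta_t\}$ is independent of the sequence $\{X_t\}$. Suppose that $X_{(\infty)}=\sum_{t=1}^\infty\Theta_tX_t$ is finite with probability one and has regularly varying tail of index $-\alpha$, that is, $\mathbb P[X_{(\infty)}>x]>0$ for all $x$, and for every $c>0$, $\mathbb P[X_{(\infty)}>cx]\sim c^{-\alpha}\,\mathbb P[X_{(\infty)}>x]$ as $x\to\infty$. Suppose also that $\{\Theta_t\}$ satisfies the appropriate Resnick--Willekens (RW) condition: - if $0<\alpha<1$, then for some $\epsilon\in(0,\alpha)$, $\sum_{t=1}^\infty\mathbb E\left[\Theta_t^{\alpha+\epsilon}+\Theta_t^{\alpha-\epsilon}\right]<\infty$;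 - if $\alpha\ge1$, then for some $\epsilon\in(0,\alpha)$, $\sum_{t=1}^\infty\left(\mathbb E\left[\Theta_t^{\alpha+\epsilon}+\Theta_t^{\alpha-\epsilon}\right]\right)^{\frac1{\alpha+\epsilon}}<\infty$. Then $\sum_{t=1}^\infty\mathbb P[\Theta_tX_t>x]<\infty$ for every $x>0$ and, as $x\to\infty$, $$\sum_{t=1}^\infty\mathbb P[\Theta_tX_t>x]\sim\mathbb P[X_{(\infty)}>x].$$ Here $a(x)\sim b(x)$ means $\lim_{x\to\infty}a(x)/b(x)=1$. -/

import Mathlib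

open MeasureTheory ProbabilityTheory Filter Topology Asymptotics

noncomputable section

namespace RandomWeightedSum

variable {Ω : Type*} [MeasurableSpace Ω]

/-- The tail function `x ↦ P[Y > x]` of a real random variable `Y`. -/
def tail (P : Measure Ω) (Y : Ω → ℝ) (x : ℝ) : ℝ :=
  P.real {ω | x < Y ω}

/-- `Y` has a regularly varying tail of index `-α`: the tail never vanishes and, for every `c > 0`,
`P[Y > c x] ∼ c ^ (-α) P[Y > x]` as `x → ∞`. -/
structure HasRegularlyVaryingTail (P : Measure Ω) (Y : Ω → ℝ) (α : ℝ) : Prop where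
  tail_pos : ∀ x : ℝ, 0 < tail P Y x
  tail_mul : ∀ c : ℝ, 0 < c →
    (fun x : ℝ => tail P Y (c * x)) ~[atTop] (fun x : ℝ => c ^ (-α) * tail P Y x)

/-- `Y` and `Z` are asymptotically independent: their tails never vanish and the joint tail
`P[Y > x, Z > x]` is negligible with respect to each of the two tails as `x → ∞`. -/
structure AsymptoticallyIndependent (P : Measure Ω) (Y Z : Ω → ℝ) : Prop where
  tail_left_pos : ∀ x : ℝ, 0 < tail P Y x
  tail_right_pos : ∀ x : ℝ, 0 < tail P Z x
  left : Tendsto (fun x : ℝ => P.real {ω | x < Y ω ∧ x < Z ω} / tail P Y x) atTop (𝓝 0)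
  right : Tendsto (fun x : ℝ => P.real {ω | x < Y ω ∧ x < Z ω} / tail P Z x) atTop (𝓝 0)

/-- `E[Θ ^ (α + ε) + Θ ^ (α - ε)]` as an element of `[0, ∞]`, for a positive random variable. -/
def momentPair (P : Measure Ω) (Θ : Ω → ℝ) (α ε : ℝ) : ENNReal :=
  ∫⁻ ω, ENNReal.ofReal (Θ ω ^ (α + ε) + Θ ω ^ (α - ε)) ∂P

/-- The Resnick-Willekens moment condition on a sequence of positive random variables, for `0 < α`,
in the form that depends on whether `α < 1` or `1 ≤ α`. -/
structure RWCondition (P : Measure Ω) (Θ : ℕ → Ω → ℝ) (α : ℝ) : Prop where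
  of_lt_one : α < 1 →
    ∃ ε : ℝ, 0 < ε ∧ ε < α ∧ ∑' t, momentPair P (Θ t) α ε < ⊤
  of_one_le : 1 ≤ α →
    ∃ ε : ℝ, 0 < ε ∧ ε < α ∧ ∑' t, momentPair P (Θ t) α ε ^ (1 / (α + ε)) < ⊤

/-- The randomly weighted series `∑ Θ_t X_t`. -/
def weightedSeries (Θ X : ℕ → Ω → ℝ) (ω : Ω) : ℝ :=
  ∑' t, Θ t ω * X t ω

end RandomWeightedSum

end

/-! One big jump governs the sum, and everything is measured against `R`, the tail of the series.
Regular variation of the tail of `X t` is neither assumed nor derived; only its domination by `R` is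
used. All terms are nonnegative, so `Θ 0 * X 0` lies below the series, and independence gives `tail
P (X 0) = O(R)`. With Potter bounds this becomes `P[X t > x / v] ≤ C R(x) (v ^ b + v ^ (α - ε))`,
uniformly in `v`. Integrating over the independent weights bounds each term by `R x` times a
summable moment (`measure_lt_mul_le`), and dominated convergence makes joint exceedances `o(R)`
(`tendsto_joint_exceedance_div`). Truncation, Minkowski and Markov bound the tail of the remainder
after `n` terms by `κ n * R x` with `κ n → 0` (`lintegral_min_rpow_le`, `measure_lt_tsum_le`).
Bonferroni then bounds the sum of tails above by `R`. Conversely, a large series has a large term,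
two moderate terms or a large remainder, and the last two cases are negligible. -/

namespace RandomWeightedSum

/-! ### Regular variation and Potter bounds -/

/-- The ratio form of regular variation. -/
lemma tendsto_ratio_of_regularlyVarying {R : ℝ → ℝ} {α : ℝ} (hpos : ∀ x, 0 < R x)
    (hrv : ∀ c : ℝ, 0 < c → (fun x => R (c * x)) ~[atTop] fun x => c ^ (-α) * R x)
    {c : ℝ} (hc : 0 < c) : Tendsto (fun x => R (c * x) / R x) atTop (𝓝 (c ^ (-α))) := by
  have hcp : 0 < c ^ (-α) := Real.rpow_pos_of_pos hc _
  have h := (isEquivalent_iff_tendsto_one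
    (Eventually.of_forall fun x => (mul_pos hcp (hpos x)).ne')).1 (hrv c hc)
  have h2 := h.const_mul (c ^ (-α))
  rw [mul_one] at h2
  refine h2.congr fun x => ?_
  have := (hpos x).ne'
  simp only [Pi.div_apply]
  field_simp

/-- Potter bounds for monotone regularly varying functions. -/
lemma potter_bound {R : ℝ → ℝ} {α a b : ℝ} (hanti : Antitone R) (hpos : ∀ x, 0 < R x)
    (hrv : ∀ c : ℝ, 0 < c → (fun x => R (c * x)) ~[atTop] fun x => c ^ (-α) * R x)
    (ha : 0 ≤ a) (haα : a < α) (hαb : α < b) :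
    ∃ x₀ > 0, ∃ A > 0, ∀ x ≥ x₀, ∀ y ≥ x₀, R y ≤ A * ((x / y) ^ b + (x / y) ^ a) * R x := by
  have hlim := tendsto_ratio_of_regularlyVarying hpos hrv (c := 2) two_pos
  have hlow : (2 : ℝ) ^ (-b) < 2 ^ (-α) := Real.rpow_lt_rpow_of_exponent_lt one_lt_two (by linarith)
  have hupp : (2 : ℝ) ^ (-α) < 2 ^ (-a) := Real.rpow_lt_rpow_of_exponent_lt one_lt_two (by linarith)
  -- Beyond `x₀` each doubling multiplies `R` by a factor between `2 ^ (-b)` and `2 ^ (-a)`.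
  -- Iteration covers dyadic ratios; monotonicity fills the gaps.
  obtain ⟨x₀, hx₀⟩ := eventually_atTop.1
    (((hlim.eventually (lt_mem_nhds hlow)).and (hlim.eventually (gt_mem_nhds hupp))).and
      (eventually_ge_atTop 1))
  have hx₀1 : 1 ≤ x₀ := (hx₀ x₀ le_rfl).2
  have hstep : ∀ x ≥ x₀, ∀ k : ℕ, ((2 : ℝ) ^ k) ^ (-b) * R x ≤ R (2 ^ k * x) ∧
      R (2 ^ k * x) ≤ ((2 : ℝ) ^ k) ^ (-a) * R x := by
    intro x hx k
    induction k with
    | zero => simp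
    | succ k ih =>
      have hk : x₀ ≤ 2 ^ k * x := by
        have : (1 : ℝ) ≤ 2 ^ k := one_le_pow₀ one_le_two
        nlinarith
      obtain ⟨⟨h1, h2⟩, -⟩ := hx₀ _ hk
      rw [lt_div_iff₀ (hpos _)] at h1
      rw [div_lt_iff₀ (hpos _)] at h2
      have e : (2 : ℝ) ^ (k + 1) * x = 2 * (2 ^ k * x) := by ring
      have e2 : ∀ r : ℝ, ((2 : ℝ) ^ (k + 1)) ^ r = 2 ^ r * (2 ^ k) ^ r := by
        intro r
        rw [pow_succ', Real.mul_rpow (by norm_num) (by positivity)]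
      rw [e, e2, e2]
      constructor
      · refine le_trans ?_ h1.le
        rw [mul_assoc]
        exact mul_le_mul_of_nonneg_left ih.1 (by positivity)
      · refine h2.le.trans ?_
        rw [mul_assoc]
        exact mul_le_mul_of_nonneg_left ih.2 (by positivity)
  -- The factor `2 ^ b` pays for rounding the ratio to a power of two.
  refine ⟨x₀, by linarith, 2 ^ b, by positivity, fun x hx y hy => ?_⟩
  have hx0 : 0 < x := by linarith
  have hy0 : 0 < y := by linarith
  have hRx := hpos x
  rcases le_total y x with hyx | hxy
  · obtain ⟨k, hk1, hk2⟩ := exists_nat_pow_near ((one_le_div hy0).2 hyx) one_lt_two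
    have h1 := (hstep y hy (k + 1)).1
    have h2 : R (2 ^ (k + 1) * y) ≤ R x := hanti ((div_lt_iff₀ hy0).1 hk2).le
    have h3 : R y ≤ ((2 : ℝ) ^ (k + 1)) ^ b * R x := by
      have hp : 0 < ((2 : ℝ) ^ (k + 1)) ^ b := by positivity
      rw [Real.rpow_neg (by positivity), inv_mul_le_iff₀ hp] at h1
      exact h1.trans (mul_le_mul_of_nonneg_left h2 hp.le)
    refine h3.trans (mul_le_mul_of_nonneg_right ?_ hRx.le)
    rw [pow_succ', Real.mul_rpow (by norm_num) (by positivity)]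
    refine mul_le_mul_of_nonneg_left ?_ (by positivity)
    have h4 : ((2 : ℝ) ^ k) ^ b ≤ (x / y) ^ b :=
      Real.rpow_le_rpow (by positivity) hk1 (by linarith)
    have h5 : 0 ≤ (x / y) ^ a := by positivity
    linarith
  · obtain ⟨k, hk1, hk2⟩ := exists_nat_pow_near ((one_le_div hx0).2 hxy) one_lt_two
    have h1 := (hstep x hx k).2
    have h2 : R y ≤ R (2 ^ k * x) := hanti ((le_div_iff₀ hx0).1 hk1)
    refine h2.trans (h1.trans (mul_le_mul_of_nonneg_right ?_ hRx.le))
    have h3 : ((2 : ℝ) ^ k) ^ (-a) = 2 ^ a * ((2 : ℝ) ^ (k + 1)) ^ (-a) := by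
      rw [pow_succ', Real.mul_rpow (by norm_num) (by positivity), ← mul_assoc,
        ← Real.rpow_add two_pos]
      simp
    have h4 : ((2 : ℝ) ^ (k + 1)) ^ (-a) ≤ (y / x) ^ (-a) :=
      Real.rpow_le_rpow_of_nonpos (by positivity) hk2.le (by linarith)
    have h5 : (y / x) ^ (-a) = (x / y) ^ a := by
      rw [Real.rpow_neg (by positivity), ← Real.inv_rpow (by positivity), inv_div]
    have h6 : (2 : ℝ) ^ a ≤ 2 ^ b := Real.rpow_le_rpow_of_exponent_le one_le_two (by linarith)
    have h7 : 0 ≤ (x / y) ^ b := by positivity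
    rw [h3]
    refine (mul_le_mul h6 h4 (by positivity) (by positivity)).trans ?_
    rw [h5]
    exact mul_le_mul_of_nonneg_left (by linarith) (by positivity)

/-- A function bounded by one and by a multiple of a regularly varying function at infinity
inherits the Potter bounds, uniformly over all arguments. -/
lemma le_rpow_add_rpow_mul_of_le_regularlyVarying {R F : ℝ → ℝ} {α a b K : ℝ}
    (hanti : Antitone R) (hpos : ∀ x, 0 < R x)
    (hrv : ∀ c : ℝ, 0 < c → (fun x => R (c * x)) ~[atTop] fun x => c ^ (-α) * R x)
    (hF1 : ∀ x, F x ≤ 1) (hFR : ∀ᶠ x in atTop, F x ≤ K * R x)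
    (ha : 0 ≤ a) (haα : a < α) (hαb : α < b) :
    ∃ x₀ > 0, ∃ C > 0, ∀ x ≥ x₀, ∀ v > 0, F (x / v) ≤ C * R x * (v ^ b + v ^ a) := by
  obtain ⟨x₁, hx₁, A, hA, hpot⟩ := potter_bound hanti hpos hrv ha haα hαb
  obtain ⟨x₂, hx₂⟩ := eventually_atTop.1 hFR
  set x₀ := max x₁ x₂
  have hx₀ : 0 < x₀ := lt_max_of_lt_left hx₁
  have hR0 := hpos x₀
  -- The first summand serves `x / v ≥ x₀`. The second serves `x / v < x₀`, where `F ≤ 1` and Potter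
  -- between `x` and `x₀` makes the right side at least one.
  refine ⟨x₀, hx₀, max K 0 * A + A / R x₀, by positivity, fun x hx v hv => ?_⟩
  have hx0 : 0 < x := by linarith
  have hRx := hpos x
  have hvv : 0 < v ^ b + v ^ a := by positivity
  have hK : 0 ≤ max K 0 * A * R x * (v ^ b + v ^ a) := by positivity
  have hAR : 0 ≤ A / R x₀ * R x * (v ^ b + v ^ a) := by positivity
  rw [add_mul, add_mul]
  rcases le_or_gt x₀ (x / v) with h | h
  · have h1 := hpot x ((le_max_left _ _).trans hx) (x / v) ((le_max_left _ _).trans h)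
    rw [div_div_cancel₀ hx0.ne'] at h1
    have h2 := hx₂ (x / v) ((le_max_right _ _).trans h)
    have h3 : K * R (x / v) ≤ max K 0 * R (x / v) :=
      mul_le_mul_of_nonneg_right (le_max_left _ _) (hpos _).le
    have h4 := mul_le_mul_of_nonneg_left h1 (le_max_right K 0)
    linarith
  · have h1 := hpot x ((le_max_left _ _).trans hx) x₀ (le_max_left _ _)
    have h2 : x / x₀ ≤ v := by
      rw [div_lt_iff₀ hv] at h
      rw [div_le_iff₀ hx₀]
      linarith
    have h3 : (x / x₀) ^ b ≤ v ^ b := Real.rpow_le_rpow (by positivity) h2 (by linarith)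
    have h4 : (x / x₀) ^ a ≤ v ^ a := Real.rpow_le_rpow (by positivity) h2 ha
    have h5 : R x₀ ≤ A * (v ^ b + v ^ a) * R x := h1.trans (by gcongr)
    have h6 : 1 ≤ A / R x₀ * R x * (v ^ b + v ^ a) := by
      rw [div_mul_eq_mul_div, div_mul_eq_mul_div, le_div_iff₀ hR0]
      linarith
    linarith [hF1 (x / v)]

/-! ### Tails of weighted variables -/

variable {Ω : Type*} [MeasurableSpace Ω] {P : Measure Ω}

lemma tail_antitone [IsFiniteMeasure P] (Y : Ω → ℝ) : Antitone (tail P Y) := fun _ _ h =>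
  measureReal_mono fun _ hω => lt_of_le_of_lt h hω

lemma ofReal_tail [IsFiniteMeasure P] (Y : Ω → ℝ) (x : ℝ) :
    ENNReal.ofReal (tail P Y x) = P {ω | x < Y ω} := ofReal_measureReal

/-- Fubini for the product law; it lets the weights be frozen while the tail of `X` is estimated. -/
lemma measure_eq_lintegral_of_indepFun [IsFiniteMeasure P] {β γ : Type*} [MeasurableSpace β]
    [MeasurableSpace γ] {U : Ω → β} {V : Ω → γ} (hU : Measurable U) (hV : Measurable V)
    (h : IndepFun U V P) {S : Set (β × γ)} (hS : MeasurableSet S) :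
    P {ω | (U ω, V ω) ∈ S} = ∫⁻ ω, P {ω' | (U ω, V ω') ∈ S} ∂P := by
  have h1 := (indepFun_iff_map_prod_eq_prod_map_map hU.aemeasurable hV.aemeasurable).1 h
  have h2 : P {ω | (U ω, V ω) ∈ S} = P.map (fun ω => (U ω, V ω)) S :=
    (Measure.map_apply (hU.prodMk hV) hS).symm
  rw [h2, h1, Measure.prod_apply hS, lintegral_map (measurable_measure_prodMk_left hS) hU]
  refine lintegral_congr fun ω => ?_
  rw [Measure.map_apply hV (measurable_prodMk_left hS)]
  rfl

/-- Powers with exponents in `[α - ε, α + ε]` are controlled by the powers at the end points. -/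
lemma rpow_le_rpow_add_rpow {u a l r : ℝ} (hu : 0 < u) (hl : l ≤ a) (hr : a ≤ r) :
    u ^ a ≤ u ^ r + u ^ l := by
  have h1 : 0 < u ^ r := by positivity
  have h2 : 0 < u ^ l := by positivity
  rcases le_total 1 u with h | h
  · linarith [Real.rpow_le_rpow_of_exponent_le h hr]
  · linarith [Real.rpow_le_rpow_of_exponent_ge hu h hl]

/-- Domination of the tail of a product, with a constant proportional to the moments of `Θ`. -/
lemma measure_lt_mul_le [IsProbabilityMeasure P] {X Θ : Ω → ℝ} {R : ℝ → ℝ} {α ε a b C x₀ : ℝ}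
    (hX : Measurable X) (hΘ : Measurable Θ) (hΘpos : ∀ᵐ ω ∂P, 0 < Θ ω)
    (hind : IndepFun Θ X P) (hRpos : ∀ x, 0 < R x) (hC : 0 < C)
    (hdom : ∀ x ≥ x₀, ∀ v > 0, tail P X (x / v) ≤ C * R x * (v ^ b + v ^ a))
    (hεa : α - ε ≤ a) (hab : a ≤ b) (hbε : b ≤ α + ε) {x w : ℝ} (hx : x₀ ≤ x) (hw : 0 < w)
    (hw1 : w ≤ 1) :
    P {ω | x * w < Θ ω * X ω} ≤
      ENNReal.ofReal (2 * C * R x * w ^ (-b)) * momentPair P Θ α ε := by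
  have hS : MeasurableSet {q : ℝ × ℝ | x * w < q.1 * q.2} :=
    measurableSet_lt measurable_const (measurable_fst.mul measurable_snd)
  have h := measure_eq_lintegral_of_indepFun hΘ hX hind hS
  simp only [Set.mem_ofPred_eq] at h
  have hRx := hRpos x
  rw [h, momentPair, ← lintegral_const_mul' _ _ ENNReal.ofReal_ne_top]
  refine lintegral_mono_ae ?_
  filter_upwards [hΘpos] with ω hω
  set u := Θ ω
  -- With the weight frozen at `u`, domination applies with `v = u / w`.
  have e : {ω' | x * w < u * X ω'} = {ω' | x / (u / w) < X ω'} := by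
    ext ω'
    simp only [Set.mem_ofPred_eq]
    rw [div_div_eq_mul_div, div_lt_iff₀ hω, mul_comm u]
  rw [e, ← ofReal_tail, ← ENNReal.ofReal_mul (by positivity)]
  refine ENNReal.ofReal_le_ofReal ((hdom x hx (u / w) (by positivity)).trans ?_)
  have h1 : (u / w) ^ b = w ^ (-b) * u ^ b := by
    rw [Real.div_rpow hω.le hw.le, Real.rpow_neg hw.le, div_eq_inv_mul]
  have h2 : (u / w) ^ a ≤ w ^ (-b) * u ^ a := by
    rw [Real.div_rpow hω.le hw.le, div_eq_inv_mul, ← Real.rpow_neg hw.le]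
    exact mul_le_mul_of_nonneg_right
      (Real.rpow_le_rpow_of_exponent_ge hw hw1 (by linarith)) (by positivity)
  have h3 := rpow_le_rpow_add_rpow hω hεa (hab.trans hbε)
  have h4 := rpow_le_rpow_add_rpow hω (hεa.trans hab) hbε
  have hwb : 0 < w ^ (-b) := by positivity
  calc C * R x * ((u / w) ^ b + (u / w) ^ a)
      ≤ C * R x * (w ^ (-b) * (2 * (u ^ (α + ε) + u ^ (α - ε)))) := by
        refine mul_le_mul_of_nonneg_left ?_ (by positivity)
        rw [h1]
        refine (add_le_add_right h2 _).trans ?_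
        rw [← mul_add]
        exact mul_le_mul_of_nonneg_left (by linarith) hwb.le
    _ = _ := by ring

/-- If `Θ X` has a tail dominated by a regularly varying `R`, so has `X`. -/
lemma tail_le_of_mul_tail_le [IsProbabilityMeasure P] {X Θ : Ω → ℝ} {R : ℝ → ℝ} {α : ℝ}
    (hΘpos : ∀ᵐ ω ∂P, 0 < Θ ω)
    (hind : IndepFun Θ X P) (hRpos : ∀ x, 0 < R x)
    (hrv : ∀ c : ℝ, 0 < c → (fun x => R (c * x)) ~[atTop] fun x => c ^ (-α) * R x)
    (hle : ∀ x, tail P (fun ω => Θ ω * X ω) x ≤ R x) :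
    ∃ K, ∀ᶠ x in atTop, tail P X x ≤ K * R x := by
  obtain ⟨c, hc, hpc⟩ : ∃ c > 0, 0 < P.real {ω | c < Θ ω} := by
    by_contra! hcon
    have h0 : ∀ n : ℕ, ∀ᵐ ω ∂P, ¬ (1 / ((n : ℝ) + 1) < Θ ω) := by
      intro n
      have h := hcon (1 / ((n : ℝ) + 1)) (by positivity)
      have h' : P.real {ω | 1 / ((n : ℝ) + 1) < Θ ω} = 0 := le_antisymm h measureReal_nonneg
      rw [measureReal_eq_zero_iff] at h'
      rw [ae_iff]
      simpa using h'
    have h1 : ∀ᵐ _ω ∂P, False := by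
      filter_upwards [ae_all_iff.2 h0, hΘpos] with ω h2 h3
      obtain ⟨n, hn⟩ := exists_nat_one_div_lt h3
      exact h2 n hn
    simp [ae_iff] at h1
  set p := P.real {ω | c < Θ ω}
  have hlim := tendsto_ratio_of_regularlyVarying hRpos hrv hc
  refine ⟨(c ^ (-α) + 1) / p, ?_⟩
  filter_upwards [hlim.eventually (gt_mem_nhds (lt_add_one _)), eventually_ge_atTop 0] with x hx hx0
  rw [div_lt_iff₀ (hRpos x)] at hx
  -- `Θ > c` and `X > x` force `Θ X > c x`; independence factors the probability.
  have h1 : p * tail P X x ≤ R (c * x) := by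
    refine le_trans ?_ (hle (c * x))
    have h2 := congrArg ENNReal.toReal (hind.measure_inter_preimage_eq_mul
      (Set.Ioi c) (Set.Ioi x) measurableSet_Ioi measurableSet_Ioi)
    rw [ENNReal.toReal_mul] at h2
    refine (h2.symm.le.trans (measureReal_mono ?_))
    rintro ω ⟨h3, h4⟩
    exact mul_lt_mul'' h3 h4 hc.le hx0
  rw [div_mul_eq_mul_div, le_div_iff₀ hpc]
  linarith

/-! ### Joint exceedances -/

/-- Joint exceedances of two weighted asymptotically independent variables are negligible. -/
lemma tendsto_joint_exceedance_div [IsProbabilityMeasure P] {X₁ X₂ Θ₁ Θ₂ : Ω → ℝ} {R : ℝ → ℝ}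
    {α ε a b C x₀ : ℝ} (hX₁ : Measurable X₁) (hX₂ : Measurable X₂) (hΘ₁ : Measurable Θ₁)
    (hΘ₂ : Measurable Θ₂) (hΘ₁pos : ∀ᵐ ω ∂P, 0 < Θ₁ ω) (hΘ₂pos : ∀ᵐ ω ∂P, 0 < Θ₂ ω)
    (hind : IndepFun (fun ω => (Θ₁ ω, Θ₂ ω)) (fun ω => (X₁ ω, X₂ ω)) P)
    (hasymp : AsymptoticallyIndependent P X₁ X₂) (hRpos : ∀ x, 0 < R x) (hC : 0 < C)
    (hdom : ∀ x ≥ x₀, ∀ v > 0, tail P X₂ (x / v) ≤ C * R x * (v ^ b + v ^ a))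
    (hεa : α - ε ≤ a) (hab : a ≤ b) (hbε : b ≤ α + ε)
    (hm₁ : momentPair P Θ₁ α ε ≠ ⊤) (hm₂ : momentPair P Θ₂ α ε ≠ ⊤) :
    Tendsto (fun x => P.real {ω | x < Θ₁ ω * X₁ ω ∧ x < Θ₂ ω * X₂ ω} / R x) atTop (𝓝 0) := by
  have hΘ := hΘ₁.prodMk hΘ₂
  have hX := hX₁.prodMk hX₂
  let S : ℝ → Set ((ℝ × ℝ) × (ℝ × ℝ)) := fun x =>
    {q | x < q.1.1 * q.2.1 ∧ x < q.1.2 * q.2.2}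
  have hS : ∀ x, MeasurableSet (S x) := by
    intro x
    have m₁ : Measurable fun q : (ℝ × ℝ) × (ℝ × ℝ) => q.1.1 * q.2.1 := by fun_prop
    have m₂ : Measurable fun q : (ℝ × ℝ) × (ℝ × ℝ) => q.1.2 * q.2.2 := by fun_prop
    exact (measurableSet_lt measurable_const m₁).inter (measurableSet_lt measurable_const m₂)
  let J : ℝ → Ω → ENNReal := fun x ω =>
    P {ω' | x < Θ₁ ω * X₁ ω' ∧ x < Θ₂ ω * X₂ ω'} / ENNReal.ofReal (R x)
  have hJmeas : ∀ x, Measurable (J x) := by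
    intro x
    have h1 : Measurable fun q : ℝ × ℝ => P.map (fun ω => (X₁ ω, X₂ ω)) (Prod.mk q ⁻¹' S x) :=
      measurable_measure_prodMk_left (hS x)
    refine Measurable.div_const ?_ _
    convert h1.comp hΘ using 2 with ω
    simp only [Function.comp]
    rw [Measure.map_apply hX (measurable_prodMk_left (hS x))]
    rfl
  have heq : ∀ x, ENNReal.ofReal
      (P.real {ω | x < Θ₁ ω * X₁ ω ∧ x < Θ₂ ω * X₂ ω} / R x) = ∫⁻ ω, J x ω ∂P := by
    intro x
    rw [ENNReal.ofReal_div_of_pos (hRpos x), ofReal_measureReal]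
    have h := measure_eq_lintegral_of_indepFun hΘ hX hind (hS x)
    change P {ω | x < Θ₁ ω * X₁ ω ∧ x < Θ₂ ω * X₂ ω} = _ at h
    rw [h]
    simp only [J, div_eq_mul_inv]
    rw [lintegral_mul_const']
    · rfl
    · simp [hRpos x]
  -- Both `X` values are positive on the event, so replacing each weight by the maximum only
  -- enlarges it and gives the common level needed for asymptotic independence.
  have hkey : ∀ ω, 0 < Θ₁ ω → 0 < Θ₂ ω → ∀ x ≥ max x₀ 0,
      J x ω ≤ ENNReal.ofReal (P.real {ω' | x / max (Θ₁ ω) (Θ₂ ω) < X₁ ω' ∧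
        x / max (Θ₁ ω) (Θ₂ ω) < X₂ ω'} / R x) := by
    intro ω h1 h2 x hx
    have hx0 : 0 ≤ x := (le_max_right _ _).trans hx
    rw [ENNReal.ofReal_div_of_pos (hRpos x), ofReal_measureReal]
    refine ENNReal.div_le_div_right (measure_mono ?_) _
    rintro ω' ⟨h3, h4⟩
    have h5 : 0 < X₁ ω' := (pos_iff_pos_of_mul_pos (hx0.trans_lt h3)).1 h1
    have h6 : 0 < X₂ ω' := (pos_iff_pos_of_mul_pos (hx0.trans_lt h4)).1 h2
    have hm : 0 < max (Θ₁ ω) (Θ₂ ω) := lt_max_of_lt_left h1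
    constructor
    · rw [div_lt_iff₀ hm, mul_comm]
      exact h3.trans_le (mul_le_mul_of_nonneg_right (le_max_left _ _) h5.le)
    · rw [div_lt_iff₀ hm, mul_comm]
      exact h4.trans_le (mul_le_mul_of_nonneg_right (le_max_right _ _) h6.le)
  have hbound : ∀ ω, 0 < Θ₁ ω → 0 < Θ₂ ω → ∀ x ≥ max x₀ 0,
      tail P X₂ (x / max (Θ₁ ω) (Θ₂ ω)) / R x ≤
        C * (max (Θ₁ ω) (Θ₂ ω) ^ b + max (Θ₁ ω) (Θ₂ ω) ^ a) := by
    intro ω h1 h2 x hx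
    rw [div_le_iff₀ (hRpos x)]
    have := hdom x ((le_max_left _ _).trans hx) _ (lt_max_of_lt_left h1 : 0 < max (Θ₁ ω) (Θ₂ ω))
    linarith
  have hlim : Tendsto (fun x => ∫⁻ ω, J x ω ∂P) atTop (𝓝 (∫⁻ _ω, 0 ∂P)) := by
    refine tendsto_lintegral_filter_of_dominated_convergence
      (fun ω => ENNReal.ofReal (2 * C * (Θ₁ ω ^ (α + ε) + Θ₁ ω ^ (α - ε))) +
        ENNReal.ofReal (2 * C * (Θ₂ ω ^ (α + ε) + Θ₂ ω ^ (α - ε))))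
      (Eventually.of_forall hJmeas) ?_ ?_ ?_
    · filter_upwards [eventually_ge_atTop (max x₀ 0)] with x hx
      filter_upwards [hΘ₁pos, hΘ₂pos] with ω h1 h2
      refine (hkey ω h1 h2 x hx).trans ?_
      rw [← ENNReal.ofReal_add (by positivity) (by positivity)]
      refine ENNReal.ofReal_le_ofReal ?_
      have h3 : P.real {ω' | x / max (Θ₁ ω) (Θ₂ ω) < X₁ ω' ∧ x / max (Θ₁ ω) (Θ₂ ω) < X₂ ω'} ≤
          tail P X₂ (x / max (Θ₁ ω) (Θ₂ ω)) := measureReal_mono fun ω' h => h.2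
      refine (div_le_div_of_nonneg_right h3 (hRpos x).le).trans ((hbound ω h1 h2 x hx).trans ?_)
      have hr : ∀ u : ℝ, 0 < u → u ^ b + u ^ a ≤ 2 * (u ^ (α + ε) + u ^ (α - ε)) := by
        intro u hu
        have := rpow_le_rpow_add_rpow hu hεa (hab.trans hbε)
        have := rpow_le_rpow_add_rpow hu (hεa.trans hab) hbε
        linarith
      have p1 : 0 < Θ₁ ω ^ (α + ε) + Θ₁ ω ^ (α - ε) := by positivity
      have p2 : 0 < Θ₂ ω ^ (α + ε) + Θ₂ ω ^ (α - ε) := by positivity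
      have h4 : max (Θ₁ ω) (Θ₂ ω) ^ b + max (Θ₁ ω) (Θ₂ ω) ^ a ≤
          2 * (Θ₁ ω ^ (α + ε) + Θ₁ ω ^ (α - ε)) + 2 * (Θ₂ ω ^ (α + ε) + Θ₂ ω ^ (α - ε)) := by
        rcases max_choice (Θ₁ ω) (Θ₂ ω) with h | h <;> rw [h]
        · linarith [hr _ h1]
        · linarith [hr _ h2]
      nlinarith
    · have hfin : ∀ Θ' : Ω → ℝ, momentPair P Θ' α ε ≠ ⊤ →
          ∫⁻ ω, ENNReal.ofReal (2 * C * (Θ' ω ^ (α + ε) + Θ' ω ^ (α - ε))) ∂P ≠ ⊤ := by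
        intro Θ' h
        simp_rw [ENNReal.ofReal_mul (show 0 ≤ 2 * C by positivity)]
        rw [lintegral_const_mul' _ _ ENNReal.ofReal_ne_top]
        exact ENNReal.mul_ne_top ENNReal.ofReal_ne_top h
      rw [lintegral_add_left (by fun_prop)]
      exact ENNReal.add_ne_top.2 ⟨hfin _ hm₁, hfin _ hm₂⟩
    · filter_upwards [hΘ₁pos, hΘ₂pos] with ω h1 h2
      have hm : 0 < max (Θ₁ ω) (Θ₂ ω) := lt_max_of_lt_left h1
      set m := max (Θ₁ ω) (Θ₂ ω)
      -- Joint tail over `R` is joint tail over `tail P X₂`, which vanishes, times `tail P X₂` over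
      -- `R`, which `hbound` keeps bounded.
      have h3 := hasymp.right.comp (tendsto_id.atTop_div_const hm)
      have h4 := h3.mul_const (C * (m ^ b + m ^ a))
      rw [zero_mul] at h4
      have h5 := ENNReal.tendsto_ofReal h4
      rw [ENNReal.ofReal_zero] at h5
      refine tendsto_of_tendsto_of_tendsto_of_le_of_le' tendsto_const_nhds h5
        (Eventually.of_forall fun _ => zero_le) ?_
      filter_upwards [eventually_ge_atTop (max x₀ 0)] with x hx
      refine (hkey ω h1 h2 x hx).trans (ENNReal.ofReal_le_ofReal ?_)
      have h6 := hasymp.tail_right_pos (x / m)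
      refine le_trans (le_of_eq ?_) (mul_le_mul_of_nonneg_left (hbound ω h1 h2 x hx)
        (div_nonneg measureReal_nonneg h6.le))
      exact (div_mul_div_cancel₀ h6.ne').symm
  rw [lintegral_zero] at hlim
  have h := (ENNReal.tendsto_toReal ENNReal.zero_ne_top).comp hlim
  refine h.congr fun x => ?_
  simp only [Function.comp]
  rw [← heq, ENNReal.toReal_ofReal (div_nonneg measureReal_nonneg (hRpos x).le)]

/-! ### Tails of series through truncated moments -/

/-- A power bound on the tail of `Y` below level `x` bounds the truncated moments of `Y`. -/
lemma lintegral_min_rpow_le {Y : Ω → ℝ} {x b c p : ℝ} {m : ENNReal}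
    (hY : Measurable Y) (hYpos : ∀ᵐ ω ∂P, 0 ≤ Y ω) (hx : 0 < x) (hp : 0 < p)
    (hbp : b < p) (hc : 0 ≤ c)
    (h : ∀ w, 0 < w → w ≤ 1 → P {ω | x * w < Y ω} ≤ ENNReal.ofReal (c * w ^ (-b)) * m) :
    ∫⁻ ω, ENNReal.ofReal (min (Y ω / x) 1 ^ p) ∂P ≤ ENNReal.ofReal (c * (p / (p - b))) * m := by
  have hint : ∫⁻ t in Set.Ioc (0 : ℝ) 1, ENNReal.ofReal (t ^ (p - 1 - b)) =
      ENNReal.ofReal (1 / (p - b)) := by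
    have h1 : -1 < p - 1 - b := by linarith
    have h2 := intervalIntegral.intervalIntegrable_rpow' (a := 0) (b := 1) h1
    rw [intervalIntegrable_iff_integrableOn_Ioc_of_le zero_le_one] at h2
    rw [← ofReal_integral_eq_lintegral_ofReal h2, ← intervalIntegral.integral_of_le zero_le_one,
      integral_rpow (Or.inl h1)]
    · have h3 : p - 1 - b + 1 = p - b := by ring
      rw [h3, Real.one_rpow, Real.zero_rpow (by linarith), sub_zero]
    · filter_upwards [ae_restrict_mem measurableSet_Ioc] with t ht
      exact Real.rpow_nonneg ht.1.le _
  rw [lintegral_rpow_eq_lintegral_meas_lt_mul P (by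
      filter_upwards [hYpos] with ω hω
      exact le_min (div_nonneg hω hx.le) zero_le_one)
    (by fun_prop) hp]
  -- The truncated variable never exceeds one, so the layer-cake integral stops there and only `w ≤
  -- 1` matters.
  have hle : ∫⁻ t in Set.Ioi (0 : ℝ), P {ω | t < min (Y ω / x) 1} * ENNReal.ofReal (t ^ (p - 1)) ≤
      ∫⁻ t in Set.Ioc (0 : ℝ) 1, (ENNReal.ofReal c * m) * ENNReal.ofReal (t ^ (p - 1 - b)) := by
    rw [← Set.Ioc_union_Ioi_eq_Ioi (zero_le_one' ℝ)]
    refine (lintegral_union_le _ _ _).trans ?_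
    have h0 : ∫⁻ t in Set.Ioi (1 : ℝ),
        P {ω | t < min (Y ω / x) 1} * ENNReal.ofReal (t ^ (p - 1)) = 0 := by
      rw [setLIntegral_congr_fun (g := fun _ => 0) measurableSet_Ioi, lintegral_zero]
      intro t ht
      have he : {ω | t < min (Y ω / x) 1} = ∅ := by
        ext ω
        simp only [Set.mem_ofPred_eq, Set.mem_empty_iff_false, iff_false, not_lt]
        exact (min_le_right _ _).trans (le_of_lt ht)
      beta_reduce
      rw [he, measure_empty, zero_mul]
    rw [h0, add_zero]
    refine setLIntegral_mono' measurableSet_Ioc fun t ht => ?_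
    have h1 : P {ω | t < min (Y ω / x) 1} ≤ ENNReal.ofReal (c * t ^ (-b)) * m := by
      refine (measure_mono fun ω hω => ?_).trans (h t ht.1 ht.2)
      have h2 : t < Y ω / x := lt_of_lt_of_le hω (min_le_left _ _)
      rw [lt_div_iff₀ hx] at h2
      change x * t < Y ω
      linarith
    refine (mul_le_mul_left h1 _).trans (le_of_eq ?_)
    have h3 : t ^ (p - 1 - b) = t ^ (-b) * t ^ (p - 1) := by
      rw [← Real.rpow_add ht.1]
      congr 1
      ring
    have h4 : 0 ≤ t ^ (-b) := Real.rpow_nonneg ht.1.le _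
    rw [h3, ENNReal.ofReal_mul hc, ENNReal.ofReal_mul h4]
    ring
  refine (mul_le_mul_right hle _).trans (le_of_eq ?_)
  rw [lintegral_const_mul _ (by fun_prop), hint, ENNReal.ofReal_mul hc, div_eq_mul_one_div p,
    ENNReal.ofReal_mul hp.le]
  ring

/-- The tail of a series of nonnegative variables is bounded by truncated `L^p` norms. -/
lemma measure_lt_tsum_le {Y : ℕ → Ω → ℝ} {x p : ℝ} {M : ℕ → ENNReal}
    (hY : ∀ t, Measurable (Y t)) (hYpos : ∀ t, ∀ᵐ ω ∂P, 0 ≤ Y t ω) (hx : 0 < x) (hp : 1 ≤ p)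
    (hsum : ∀ᵐ ω ∂P, Summable fun t => Y t ω)
    (hM : ∀ t, ∫⁻ ω, ENNReal.ofReal (min (Y t ω / x) 1 ^ p) ∂P ≤ M t) :
    P {ω | x < ∑' t, Y t ω} ≤ (∑' t, M t ^ (1 / p)) ^ p := by
  have hp0 : 0 < p := by linarith
  let g : ℕ → Ω → ENNReal := fun t ω => ENNReal.ofReal (min (Y t ω / x) 1)
  have hg : ∀ t, Measurable (g t) := fun t => by fun_prop
  let A : ℕ → Set Ω := fun N => {ω | 1 ≤ ∑ t ∈ Finset.range N, g t ω}
  have hmono : Monotone A := by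
    intro N N' h ω hω
    have hω' : 1 ≤ ∑ t ∈ Finset.range N, g t ω := hω
    exact hω'.trans (Finset.sum_le_sum_of_subset (Finset.range_mono h))
  have hsub : P {ω | x < ∑' t, Y t ω} ≤ P (⋃ N, A N) := by
    refine measure_mono_ae ?_
    filter_upwards [hsum, ae_all_iff.2 hYpos] with ω h1 h2 (h3 : x < ∑' t, Y t ω)
    obtain ⟨N, hN⟩ := ((h1.hasSum.tendsto_sum_nat).eventually (lt_mem_nhds h3)).exists
    refine Set.mem_iUnion.2 ⟨N, ?_⟩
    have hmin : ∀ t, 0 ≤ min (Y t ω / x) 1 := fun t =>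
      le_min (div_nonneg (h2 t) hx.le) zero_le_one
    change 1 ≤ ∑ t ∈ Finset.range N, g t ω
    rw [← ENNReal.ofReal_sum_of_nonneg fun t _ => hmin t, ENNReal.one_le_ofReal]
    -- Either one truncated term already equals one, or no truncation is active.
    by_cases h : ∃ t ∈ Finset.range N, 1 ≤ Y t ω / x
    · obtain ⟨t, ht, h4⟩ := h
      have h5 := Finset.single_le_sum (f := fun t => min (Y t ω / x) 1) (fun t _ => hmin t) ht
      rwa [min_eq_right h4] at h5
    · push Not at h
      rw [Finset.sum_congr rfl fun t ht => min_eq_left (h t ht).le, ← Finset.sum_div,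
        one_le_div hx]
      exact hN.le
  refine hsub.trans ?_
  rw [hmono.measure_iUnion]
  refine iSup_le fun N => ?_
  -- Markov for the `p`-th power; Minkowski follows in `h3`.
  have h1 : P (A N) ≤ ∫⁻ ω, (∑ t ∈ Finset.range N, g t ω) ^ p ∂P := by
    have h2 := mul_meas_ge_le_lintegral (μ := P) (f := fun ω => (∑ t ∈ Finset.range N, g t ω) ^ p)
      (by fun_prop) 1
    rw [one_mul] at h2
    refine le_trans (measure_mono fun ω hω => ?_) h2
    have hω' : 1 ≤ ∑ t ∈ Finset.range N, g t ω := hω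
    exact ENNReal.one_le_rpow hω' hp0
  refine h1.trans ?_
  have h3 := eLpNorm'_sum_le (μ := P) (f := g) (s := Finset.range N)
    (fun t _ => (hg t).aestronglyMeasurable) hp
  have h4 : ∀ t, eLpNorm' (g t) p P ≤ M t ^ (1 / p) := by
    intro t
    refine ENNReal.rpow_le_rpow (le_trans (lintegral_mono_ae ?_) (hM t)) (by positivity)
    filter_upwards [hYpos t] with ω hω
    rw [enorm_eq_self, ENNReal.ofReal_rpow_of_nonneg
      (le_min (div_nonneg hω hx.le) zero_le_one) hp0.le]
  have h5 : eLpNorm' (∑ t ∈ Finset.range N, g t) p P ≤ ∑' t, M t ^ (1 / p) :=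
    h3.trans ((Finset.sum_le_sum fun t _ => h4 t).trans (ENNReal.sum_le_tsum _))
  have h6 := ENNReal.rpow_le_rpow h5 hp0.le
  rw [eLpNorm', ← ENNReal.rpow_mul, one_div_mul_cancel hp0.ne', ENNReal.rpow_one] at h6
  simpa only [enorm_eq_self, Finset.sum_apply] using h6

/-! ### Bonferroni, one big jump and the limit -/

/-- Bonferroni inequality. -/
lemma sum_measureReal_le [IsFiniteMeasure P] {A : ℕ → Set Ω} (hA : ∀ t, MeasurableSet (A t))
    (n : ℕ) : ∑ t ∈ Finset.range n, P.real (A t) ≤ P.real (⋃ t ∈ Finset.range n, A t) +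
      ∑ t ∈ Finset.range n, ∑ s ∈ Finset.range t, P.real (A s ∩ A t) := by
  induction n with
  | zero => simp
  | succ n ih =>
    rw [Finset.sum_range_succ, Finset.sum_range_succ, Finset.range_add_one,
      Finset.set_biUnion_insert]
    have h1 := measureReal_union_add_inter (μ := P) (s := A n)
      (t := ⋃ t ∈ Finset.range n, A t) (Finset.measurableSet_biUnion _ fun t _ => hA t)
      (measure_ne_top _ _) (measure_ne_top _ _)
    have h2 : P.real (A n ∩ ⋃ t ∈ Finset.range n, A t) ≤
        ∑ s ∈ Finset.range n, P.real (A s ∩ A n) := by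
      rw [Set.inter_iUnion₂]
      refine (measureReal_biUnion_finset_le _ _).trans (le_of_eq ?_)
      simp only [Set.inter_comm]
    linarith

/-- One big jump: a large sum has a large term, two moderately large terms, or a large
remainder. -/
lemma exists_large_term_of_lt_tsum {y : ℕ → ℝ} {x δ : ℝ} {n : ℕ}
    (hsum : Summable y) (hx : 0 < x) (hδ : 0 < δ) (hn : 0 < n)
    (h : x < ∑' t, y t) :
    (∃ t < n, (1 - 2 * δ) * x < y t) ∨
    (∃ t < n, ∃ s < t, δ * x / n < y s ∧ δ * x / n < y t) ∨ δ * x < ∑' t, y (t + n) := by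
  by_contra! hcon
  obtain ⟨h1, h2, h3⟩ := hcon
  have hsplit := hsum.sum_add_tsum_nat_add n
  obtain ⟨s, hs, hmax⟩ := Finset.exists_max_image (Finset.range n) y ⟨0, Finset.mem_range.2 hn⟩
  have h4 := h1 s (Finset.mem_range.1 hs)
  have h5 := Finset.add_sum_erase _ y hs
  have hn' : (0 : ℝ) < n := by exact_mod_cast hn
  have hq : 0 < δ * x / n := by positivity
  -- Otherwise the largest term, the other `n - 1` terms and the remainder total at most `(1 - 2δ)x
  -- + δx + δx = x`. The largest term then exceeds `δx/n` too, giving the forbidden pair.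
  obtain ⟨t, ht, h6⟩ : ∃ t ∈ (Finset.range n).erase s, δ * x / n < y t := by
    by_contra! hc
    have h7 := Finset.sum_le_card_nsmul _ _ _ hc
    have h8 : ((Finset.range n).erase s).card ≤ n := by
      simpa using Finset.card_le_card (Finset.erase_subset s (Finset.range n))
    have h9 : (((Finset.range n).erase s).card : ℝ) * (δ * x / n) ≤ n * (δ * x / n) :=
      mul_le_mul_of_nonneg_right (by exact_mod_cast h8) hq.le
    rw [mul_div_cancel₀ _ hn'.ne'] at h9
    rw [nsmul_eq_mul] at h7
    nlinarith
  have h7 := h6.trans_le (hmax t (Finset.mem_of_mem_erase ht))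
  rcases lt_or_gt_of_ne (Finset.ne_of_mem_erase ht) with hlt | hlt
  · exact (h2 s (Finset.mem_range.1 hs) t hlt h6).not_gt h7
  · exact (h2 t (Finset.mem_range.1 (Finset.mem_of_mem_erase ht)) s hlt h7).not_gt h6

/-- The asymptotic comparison of the sum of tails with the tail of the sum, from bounds on
single terms, joint exceedances and remainders. -/
lemma tendsto_tsum_div_of_bounds {R : ℝ → ℝ} {T : ℕ → ℝ → ℝ} {J : ℕ → ℕ → ℝ → ℝ}
    {D : ℕ → ℝ → ℝ} {m κ : ℕ → ℝ} {α x₀ : ℝ} (hRpos : ∀ x, 0 < R x)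
    (hrv : ∀ c : ℝ, 0 < c → (fun x => R (c * x)) ~[atTop] fun x => c ^ (-α) * R x)
    (hT0 : ∀ t x, 0 ≤ T t x) (hm : Summable m) (hT : ∀ t, ∀ x ≥ x₀, T t x ≤ R x * m t)
    (hJ : ∀ s t, s < t → Tendsto (fun x => J s t x / R x) atTop (𝓝 0))
    (hκ : Tendsto κ atTop (𝓝 0)) (hD : ∀ n, ∀ x ≥ x₀, D n x ≤ R x * κ n)
    (hlow : ∀ n x, 0 < x → ∑ t ∈ Finset.range n, T t x ≤
      R x + ∑ t ∈ Finset.range n, ∑ s ∈ Finset.range t, J s t x)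
    (hupp : ∀ c : ℝ, 0 < c → c < 1 → ∃ d > 0, ∀ n : ℕ, 0 < n → ∃ e > 0, ∀ x > 0,
      R (c⁻¹ * x) ≤ ∑ t ∈ Finset.range n, T t x +
        ∑ t ∈ Finset.range n, ∑ s ∈ Finset.range t, J s t (e * x) + D n (d * x)) :
    Tendsto (fun x => (∑' t, T t x) / R x) atTop (𝓝 1) := by
  have hTsum : ∀ x ≥ x₀, Summable fun t => T t x := fun x hx =>
    Summable.of_nonneg_of_le (fun t => hT0 t x) (fun t => hT t x hx) (hm.mul_left _)
  have hratio := fun {c : ℝ} (hc : 0 < c) => tendsto_ratio_of_regularlyVarying hRpos hrv hc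
  have hJe : ∀ n : ℕ, ∀ e > 0, Tendsto
      (fun x => (∑ t ∈ Finset.range n, ∑ s ∈ Finset.range t, J s t (e * x)) / R x)
      atTop (𝓝 0) := by
    intro n e he
    simp only [Finset.sum_div]
    rw [← Finset.sum_const_zero (s := Finset.range n)]
    refine tendsto_finsetSum _ fun t _ => ?_
    rw [← Finset.sum_const_zero (s := Finset.range t)]
    refine tendsto_finsetSum _ fun s hs => ?_
    have h1 := ((hJ s t (Finset.mem_range.1 hs)).comp
      (tendsto_id.const_mul_atTop he)).mul (hratio he)
    rw [zero_mul] at h1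
    refine h1.congr fun x => ?_
    exact div_mul_div_cancel₀ (hRpos _).ne'
  rw [tendsto_order]
  constructor
  · intro r hr
    -- Lower limit: the loss `(c⁻¹) ^ (-α)` tends to one as `c` increases to one.
    obtain ⟨c, hc0, hc1, hcr⟩ : ∃ c : ℝ, 0 < c ∧ c < 1 ∧ r < (c⁻¹) ^ (-α) := by
      have hcont : Tendsto (fun c : ℝ => (c⁻¹) ^ (-α)) (𝓝[<] 1) (𝓝 1) := by
        have h1 : ContinuousAt (fun c : ℝ => (c⁻¹) ^ (-α)) 1 :=
          (continuousAt_inv₀ one_ne_zero).rpow_const (Or.inl (by norm_num))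
        have h2 := h1.tendsto.mono_left (nhdsWithin_le_nhds (s := Set.Iio 1))
        simpa using h2
      obtain ⟨c, h3, h1, h2⟩ := ((hcont.eventually (lt_mem_nhds hr)).and
        (Ioo_mem_nhdsLT (zero_lt_one' ℝ))).exists
      exact ⟨c, h1, h2, h3⟩
    -- `d` is fixed before `n`, so `κ n * d ^ (-α)` can be made small; `e` may depend on `n`.
    obtain ⟨d, hd, hupp⟩ := hupp c hc0 hc1
    obtain ⟨n, hn, hnr⟩ : ∃ n : ℕ, 0 < n ∧ r < (c⁻¹) ^ (-α) - 0 - κ n * d ^ (-α) := by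
      have h1 : Tendsto (fun n => (c⁻¹) ^ (-α) - 0 - κ n * d ^ (-α)) atTop
          (𝓝 ((c⁻¹) ^ (-α) - 0 - 0 * d ^ (-α))) :=
        tendsto_const_nhds.sub (hκ.mul_const _)
      have h2 : r < (c⁻¹) ^ (-α) - 0 - 0 * d ^ (-α) := by simpa using hcr
      exact ((eventually_gt_atTop 0).and (h1.eventually (lt_mem_nhds h2))).exists
    obtain ⟨e, he, hupp⟩ := hupp n hn
    have hlim := ((hratio (inv_pos.2 hc0)).sub (hJe n e he)).sub
      ((hratio hd).const_mul (κ n))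
    filter_upwards [hlim.eventually (lt_mem_nhds hnr), eventually_gt_atTop 0,
      eventually_ge_atTop x₀, eventually_ge_atTop (x₀ / d)] with x hx hx0 hxx hxd
    refine hx.trans_le ?_
    have hRx := hRpos x
    rw [div_sub_div_same, ← mul_div_assoc, div_sub_div_same]
    refine div_le_div_of_nonneg_right ?_ hRx.le
    have h1 := hupp x hx0
    have h2 := hD n (d * x) (by rw [div_le_iff₀ hd] at hxd; linarith)
    have h3 := (hTsum x hxx).sum_le_tsum (Finset.range n) fun t _ => hT0 t x
    linarith
  · intro r hr
    -- Upper limit: Bonferroni for the first `n` terms, the summable majorant for the rest.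
    have h0 : Tendsto (fun n => 1 + 0 + ∑' t, m (t + n)) atTop (𝓝 (1 + 0 + 0)) :=
      tendsto_const_nhds.add (tendsto_sum_nat_add m)
    obtain ⟨n, hn⟩ := (h0.eventually (gt_mem_nhds (show 1 + 0 + 0 < r by simpa using hr))).exists
    have hlim := ((tendsto_const_nhds (x := (1 : ℝ))).add (hJe n 1 one_pos)).add
      (tendsto_const_nhds (x := ∑' t, m (t + n)))
    filter_upwards [hlim.eventually (gt_mem_nhds hn), eventually_gt_atTop 0,
      eventually_ge_atTop x₀] with x hx hx0 hxx
    refine lt_of_le_of_lt ?_ hx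
    have hRx := hRpos x
    rw [div_le_iff₀ hRx, add_mul, add_mul, div_mul_cancel₀ _ hRx.ne']
    simp only [one_mul]
    have h1 := (hTsum x hxx).sum_add_tsum_nat_add n
    have h2 : ∑' t, T (t + n) x ≤ ∑' t, R x * m (t + n) :=
      Summable.tsum_le_tsum (fun t => hT _ x hxx) ((summable_nat_add_iff n).2 (hTsum x hxx))
        (((summable_nat_add_iff n).2 hm).mul_left _)
    rw [tsum_mul_left] at h2
    have h3 := hlow n x hx0
    linarith

/-! ### The moment condition -/

/-- Each `M t ^ (1 / p)` is at most the total `S`, so `M t ≤ M t ^ (1 / p) * S ^ (p - 1)`. -/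
lemma tsum_ne_top_of_tsum_rpow_ne_top {M : ℕ → ENNReal} {p : ℝ} (hp : 1 ≤ p)
    (h : ∑' t, M t ^ (1 / p) ≠ ⊤) : ∑' t, M t ≠ ⊤ := by
  have hp0 : 0 < p := by linarith
  have hle : ∀ t, M t ≤ M t ^ (1 / p) * (∑' s, M s ^ (1 / p)) ^ (p - 1) := by
    intro t
    have h1 : M t = M t ^ (1 / p) * (M t ^ (1 / p)) ^ (p - 1) := by
      have h2 : (M t ^ (1 / p)) ^ (1 + (p - 1)) = M t := by
        rw [← ENNReal.rpow_mul, add_sub_cancel, one_div_mul_cancel hp0.ne', ENNReal.rpow_one]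
      conv_lhs => rw [← h2, ENNReal.rpow_add_of_nonneg _ _ zero_le_one (by linarith),
        ENNReal.rpow_one]
    conv_lhs => rw [h1]
    exact mul_le_mul_right (ENNReal.rpow_le_rpow (ENNReal.le_tsum t) (by linarith)) _
  refine ne_top_of_le_ne_top ?_ (ENNReal.tsum_le_tsum hle)
  rw [ENNReal.tsum_mul_right]
  exact ENNReal.mul_ne_top h (ENNReal.rpow_ne_top_of_nonneg (by linarith) h)

/-- Both forms of the Resnick-Willekens condition as one summability condition. -/
lemma RWCondition.exists_exponent {Θ : ℕ → Ω → ℝ} {α : ℝ} (h : RWCondition P Θ α) :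
    ∃ ε p : ℝ, 0 < ε ∧ ε < α ∧ 1 ≤ p ∧ α < p ∧ ∑' t, momentPair P (Θ t) α ε ^ (1 / p) ≠ ⊤ := by
  rcases lt_or_ge α 1 with h1 | h1
  · obtain ⟨ε, h2, h3, h4⟩ := h.of_lt_one h1
    exact ⟨ε, 1, h2, h3, le_rfl, h1, by simpa using h4.ne⟩
  · obtain ⟨ε, h2, h3, h4⟩ := h.of_one_le h1
    exact ⟨ε, α + ε, h2, h3, by linarith, by linarith, h4.ne⟩

end RandomWeightedSum

/-! ### Proof of the theorem -/

theorem mainTheorem5 {Ω : Type*} [MeasurableSpace Ω]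
    (P : MeasureTheory.Measure Ω) [MeasureTheory.IsProbabilityMeasure P]
    (X Θ : ℕ → Ω → ℝ) (α : ℝ) (hα : 0 < α)
    (hX : ∀ t, Measurable (X t)) (hΘ : ∀ t, Measurable (Θ t))
    (hXpos : ∀ t, ∀ᵐ ω ∂P, 0 < X t ω) (hΘpos : ∀ t, ∀ᵐ ω ∂P, 0 < Θ t ω)
    (hident : ∀ s t, ProbabilityTheory.IdentDistrib (X s) (X t) P P)
    (hasymp : ∀ s t, s ≠ t →
      RandomWeightedSum.AsymptoticallyIndependent P (X s) (X t))
    (hindep : ProbabilityTheory.IndepFun (fun ω t => Θ t ω) (fun ω t => X t ω) P)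
    (hfinite : ∀ᵐ ω ∂P, Summable (fun t => Θ t ω * X t ω))
    (hregular : RandomWeightedSum.HasRegularlyVaryingTail P
      (RandomWeightedSum.weightedSeries Θ X) α)
    (hRW : RandomWeightedSum.RWCondition P Θ α) :
    (∀ x : ℝ, 0 < x →
      Summable (fun t => RandomWeightedSum.tail P (fun ω => Θ t ω * X t ω) x)) ∧
    Asymptotics.IsEquivalent Filter.atTop
      (fun x : ℝ => ∑' t, RandomWeightedSum.tail P (fun ω => Θ t ω * X t ω) x)
      (fun x : ℝ => RandomWeightedSum.tail P (RandomWeightedSum.weightedSeries Θ X) x) := by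
  open RandomWeightedSum in
  obtain ⟨ε, p, hε, hεα, hp, hαp, hsum⟩ := hRW.exists_exponent
  have hmsum := tsum_ne_top_of_tsum_rpow_ne_top hp hsum
  have hmtop : ∀ t, momentPair P (Θ t) α ε ≠ ⊤ := ENNReal.ne_top_of_tsum_ne_top hmsum
  have hp0 : 0 < p := by linarith
  obtain ⟨hRpos, hrv⟩ := hregular
  set R : ℝ → ℝ := tail P (weightedSeries Θ X)
  have hanti : Antitone R := tail_antitone _
  have hY : ∀ t, Measurable fun ω => Θ t ω * X t ω := fun t => (hΘ t).mul (hX t)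
  have hYpos : ∀ t, ∀ᵐ ω ∂P, 0 ≤ Θ t ω * X t ω := fun t => by
    filter_upwards [hXpos t, hΘpos t] with ω h1 h2
    exact (mul_pos h2 h1).le
  have hYall := ae_all_iff.2 hYpos
  have hind : ∀ t, IndepFun (Θ t) (X t) P := fun t =>
    hindep.comp (φ := fun f : ℕ → ℝ => f t) (ψ := fun f : ℕ → ℝ => f t)
      (measurable_pi_apply t) (measurable_pi_apply t)
  have hind2 : ∀ s t, IndepFun (fun ω => (Θ s ω, Θ t ω)) (fun ω => (X s ω, X t ω)) P :=
    fun s t => hindep.comp (φ := fun f : ℕ → ℝ => (f s, f t)) (ψ := fun f : ℕ → ℝ => (f s, f t))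
      (by fun_prop) (by fun_prop)
  have htail : ∀ t, tail P (X t) = tail P (X 0) := fun t => by
    ext x
    exact congrArg ENNReal.toReal ((hident t 0).measure_mem_eq (measurableSet_Ioi (a := x)))
  obtain ⟨K, hK⟩ := tail_le_of_mul_tail_le (hΘpos 0) (hind 0) hRpos hrv fun x => by
    refine ENNReal.toReal_mono (measure_ne_top _ _) (measure_mono_ae ?_)
    filter_upwards [hfinite, hYall] with ω h1 h2 h3
    exact lt_of_lt_of_le h3 (h1.le_tsum 0 fun t _ => h2 t)
  -- Potter needs `α < b`, the moments `b ≤ α + ε`, and the truncated integral strictly `b < p`.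
  -- Since `p` may equal `α + ε`, the midpoint of `α` and `p` enters.
  obtain ⟨b, hαb, hbε, hbp⟩ : ∃ b, α < b ∧ b ≤ α + ε ∧ b < p :=
    ⟨min (α + ε) ((α + p) / 2), lt_min (by linarith) (by linarith), min_le_left _ _,
      (min_le_right _ _).trans_lt (by linarith)⟩
  obtain ⟨x₀, hx₀, C, hC, hdom0⟩ := le_rpow_add_rpow_mul_of_le_regularlyVarying
    (a := α - ε) (b := b) hanti hRpos hrv (fun _ => measureReal_le_one) hK (by linarith)
    (by linarith) hαb
  have hdom : ∀ t, ∀ x ≥ x₀, ∀ v > 0,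
      tail P (X t) (x / v) ≤ C * R x * (v ^ b + v ^ (α - ε)) := fun t => by
    rw [htail t]
    exact hdom0
  have hterm := fun (t : ℕ) {x w : ℝ} (hx : x₀ ≤ x) (hw : 0 < w) (hw1 : w ≤ 1) =>
    measure_lt_mul_le (hX t) (hΘ t) (hΘpos t) (hind t) hRpos hC (hdom t) le_rfl
      (by linarith) hbε hx hw hw1
  have hsummable : ∀ x : ℝ, 0 < x → Summable fun t => tail P (fun ω => Θ t ω * X t ω) x := by
    intro x hx
    -- Levels below `x₀` are reached by scaling a level `z ≥ x₀` down by `w ≤ 1`.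
    obtain ⟨z, w, hz, hw, hw1, rfl⟩ : ∃ z w : ℝ, x₀ ≤ z ∧ 0 < w ∧ w ≤ 1 ∧ z * w = x :=
      ⟨max x₀ x, x / max x₀ x, le_max_left _ _, by positivity,
        (div_le_one (by positivity)).2 (le_max_right _ _), mul_div_cancel₀ _ (by positivity)⟩
    refine ENNReal.summable_toReal (ne_top_of_le_ne_top ?_
      (ENNReal.tsum_le_tsum fun t => hterm t hz hw hw1))
    rw [ENNReal.tsum_mul_left]
    exact ENNReal.mul_ne_top ENNReal.ofReal_ne_top hmsum
  refine ⟨hsummable, (isEquivalent_iff_tendsto_one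
    (Eventually.of_forall fun x => (hRpos x).ne')).2 ?_⟩
  have hκlim : Tendsto (fun n => 2 * C * (p / (p - b)) *
      ((∑' t, momentPair P (Θ (t + n)) α ε ^ (1 / p)) ^ p).toReal) atTop (𝓝 0) := by
    have h1 := ENNReal.tendsto_sum_nat_add _ hsum
    have h2 := ((ENNReal.continuous_rpow_const (y := p)).tendsto 0).comp h1
    rw [ENNReal.zero_rpow_of_pos hp0] at h2
    have h3 := ((ENNReal.tendsto_toReal ENNReal.zero_ne_top).comp h2).const_mul
      (2 * C * (p / (p - b)))
    simpa using h3
  have hpb : 0 < p / (p - b) := div_pos hp0 (by linarith)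
  refine tendsto_tsum_div_of_bounds (T := fun t => tail P fun ω => Θ t ω * X t ω)
    (J := fun s t x => P.real {ω | x < Θ s ω * X s ω ∧ x < Θ t ω * X t ω})
    (D := fun n => tail P fun ω => ∑' t, Θ (t + n) ω * X (t + n) ω)
    (m := fun t => 2 * C * (momentPair P (Θ t) α ε).toReal) (x₀ := x₀) hRpos hrv
    (fun _ _ => measureReal_nonneg) ((ENNReal.summable_toReal hmsum).mul_left _) ?_ ?_ hκlim
    ?_ ?_ ?_
  · intro t x hx
    have h1 := hterm t hx one_pos le_rfl
    rw [mul_one, Real.one_rpow, mul_one] at h1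
    have h2 := ENNReal.toReal_mono (ENNReal.mul_ne_top ENNReal.ofReal_ne_top (hmtop t)) h1
    have hRx := hRpos x
    rw [ENNReal.toReal_mul, ENNReal.toReal_ofReal (by positivity)] at h2
    refine h2.trans (le_of_eq ?_)
    ring
  · intro s t hst
    exact tendsto_joint_exceedance_div (hX s) (hX t) (hΘ s) (hΘ t) (hΘpos s) (hΘpos t)
      (hind2 s t) (hasymp s t hst.ne) hRpos hC (hdom t) le_rfl (by linarith) hbε
      (hmtop s) (hmtop t)
  · intro n x hx
    have hx0 : 0 < x := by linarith
    have hRx := hRpos x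
    have h1 := measure_lt_tsum_le (P := P) (Y := fun t ω => Θ (t + n) ω * X (t + n) ω)
      (fun t => hY (t + n)) (fun t => hYpos (t + n)) hx0 hp
      (by filter_upwards [hfinite] with ω h; exact (summable_nat_add_iff n).2 h)
      (fun t => lintegral_min_rpow_le (hY (t + n)) (hYpos (t + n)) hx0 hp0 hbp
        (c := 2 * C * R x) (by positivity) fun w hw hw1 => hterm (t + n) hx hw hw1)
    -- The constant leaves the sum with power `1 / p` and is then raised to `p`, so the bound stays
    -- linear in `R x`.
    simp_rw [ENNReal.mul_rpow_of_nonneg _ _ (show 0 ≤ 1 / p by positivity)] at h1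
    rw [ENNReal.tsum_mul_left, ENNReal.mul_rpow_of_nonneg _ _ hp0.le, ← ENNReal.rpow_mul,
      one_div_mul_cancel hp0.ne', ENNReal.rpow_one] at h1
    have h2 : ∑' t, momentPair P (Θ (t + n)) α ε ^ (1 / p) ≠ ⊤ :=
      ne_top_of_le_ne_top hsum (ENNReal.tsum_comp_le_tsum_of_injective
        (add_left_injective n) fun t => momentPair P (Θ t) α ε ^ (1 / p))
    have h3 := ENNReal.toReal_mono (ENNReal.mul_ne_top ENNReal.ofReal_ne_top
      (ENNReal.rpow_ne_top_of_nonneg hp0.le h2)) h1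
    rw [ENNReal.toReal_mul, ENNReal.toReal_ofReal (by positivity)] at h3
    refine h3.trans (le_of_eq ?_)
    ring
  · intro n x hx
    refine (sum_measureReal_le (fun t => measurableSet_lt measurable_const (hY t)) n).trans ?_
    refine add_le_add_left ?_ _
    refine ENNReal.toReal_mono (measure_ne_top _ _) (measure_mono_ae ?_)
    filter_upwards [hfinite, hYall] with ω h1 h2 h3
    obtain ⟨t, -, h4⟩ := Set.mem_iUnion₂.1 h3
    exact lt_of_lt_of_le h4 (h1.le_tsum t fun s _ => h2 s)
  · intro c hc0 hc1
    -- This makes `1 - 2 * δ = c`, so at series level `c⁻¹ * x` the big term exceeds exactly `x`.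
    set δ := (1 - c) / 2 with hδ
    have hδ0 : 0 < δ := by linarith
    refine ⟨δ * c⁻¹, by positivity, fun n hn => ?_⟩
    have hn' : (0 : ℝ) < n := by exact_mod_cast hn
    refine ⟨δ * c⁻¹ / n, by positivity, fun x hx => ?_⟩
    have h1 : R (c⁻¹ * x) ≤ P.real
        ((⋃ t ∈ Finset.range n, {ω | x < Θ t ω * X t ω}) ∪
          (⋃ t ∈ Finset.range n, ⋃ s ∈ Finset.range t,
            {ω | δ * c⁻¹ / n * x < Θ s ω * X s ω ∧ δ * c⁻¹ / n * x < Θ t ω * X t ω}) ∪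
          {ω | δ * c⁻¹ * x < ∑' t, Θ (t + n) ω * X (t + n) ω}) := by
      refine ENNReal.toReal_mono (measure_ne_top _ _) (measure_mono_ae ?_)
      filter_upwards [hfinite] with ω h2 h3
      have e1 : (1 - 2 * δ) * (c⁻¹ * x) = x := by
        rw [hδ]
        field_simp
        ring
      have e2 : δ * (c⁻¹ * x) / n = δ * c⁻¹ / n * x := by ring
      have h4 := exists_large_term_of_lt_tsum h2 (by positivity) hδ0 hn h3
      rw [e1, e2, ← mul_assoc δ] at h4
      rcases h4 with ⟨t, ht, h5⟩ | ⟨t, ht, s, hs, h5⟩ | h5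
      · exact Or.inl (Or.inl (Set.mem_iUnion₂.2 ⟨t, Finset.mem_range.2 ht, h5⟩))
      · exact Or.inl (Or.inr (Set.mem_iUnion₂.2 ⟨t, Finset.mem_range.2 ht,
          Set.mem_iUnion₂.2 ⟨s, Finset.mem_range.2 hs, h5⟩⟩))
      · exact Or.inr h5
    refine h1.trans ((measureReal_union_le _ _).trans (add_le_add_left
      ((measureReal_union_le _ _).trans (add_le_add (measureReal_biUnion_finset_le _ _)
        ((measureReal_biUnion_finset_le _ _).trans (Finset.sum_le_sum fun t _ =>
          measureReal_biUnion_finset_le _ _)))) _))
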